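/- Let $K$ be a (possibly non-commutative) division ring and $V$ a right $K$-vector space (of arbitrary dimension). An admissible pair of $K$ is a pair $(\sigma,\varepsilon)$ where $\sigma$ is an anti-automorphism of $K$ and $\varepsilon\in K$ satisfies $\varepsilon^\sigma\varepsilon=1$ and $t^{\sigma^2}=\varepsilon t\varepsilon^{-1}$ for all $t\in K$. Put $K_{\sigma,\varepsilon}=\{t-t^\sigma\varepsilon : t\in K\}$, $\overline{K}^{\sigma,\varepsilon}=K/K_{\sigma,\varepsilon}$ (quotient of additive groups), $\bar t=t+K_{\sigma,\varepsilon}$ and $\bar t\circ_\sigma\lambda=\overline{\lambda^\sigma t\lambda}$. A subgroup $\overline{R}$ of $\overline{K}^{\sigma,\varepsilon}$ is $\circ_\sigma$-closed if $\overline{R}\circ_\sigma\lambda\subseteq\overline{R}$ for all $\lambda\in K$; then $\circ_\sigma$ also acts on $\overline{K}^{\sigma,\varepsilon}/\overline{R}$. A generalized $(\sigma,\varepsilon)$-quadratic form with co-defect $\overline{R}$ is a map $q:V\to\overline{K}^{\sigma,\varepsilon}/\overline{R}$ such that $q(x\lambda)=q(x)\circ_\sigma\lambda$ for all $x\in V$,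 $\lambda\in K$, and such that there is a biadditive map $f:V\times V\to K$ with $f(x\lambda,y\mu)=\lambda^\sigma f(x,y)\mu$, $f(y,x)=f(x,y)^\sigma\varepsilon$ and $f(x,x)\in\{t+t^\sigma\varepsilon : t\in K\}$ for which $q(x+y)=q(x)+q(y)+(\overline{f(x,y)}+\overline{R})$ for all $x,y\in V$. Let $S_q=(P_q,L_q)$ be the geometry of the points $P_q$ and the lines $L_q$ of $\mathrm{PG}(V)$ on all vectors of which $q$ vanishes. The radical $D$ of $S_q$ is the set of the points of $S_q$ collinear in $S_q$ with all points of $S_q$. The quotient of $S_q$ over $D$ has as points the subspaces $\langle D,p\rangle$ of $S_q$ for $p\in P_q\setminus D$, and as lines the sets $\{\langle D,p\rangle : p\in l\}$ for the lines $l\in L_q$ disjoint from $D$. The non-degenerate rank of $S_q$ is the rank of this quotient, that is, the supremum of the lengths $n$ of the chains $X_0\subset X_1\subset\dots\subset X_n$ of its singular subspaces (the subspaces, including the empty one, whose points are pairwise collinear). **Theorem 3.8.** For $i=1,2$ let $(\sigma_i,\varepsilon_i)$ be an admissible pair of $K$, let $\overline{R}_i$ be a $\circ_{\sigma_i}$-closed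 subgroup of $\overline{K}^{\sigma_i,\varepsilon_i}$, and let $q_i:V\to\overline{K}^{\sigma_i,\varepsilon_i}/\overline{R}_i$ be a generalized $(\sigma_i,\varepsilon_i)$-quadratic form. Suppose that $S_{q_1}=S_{q_2}$ and that this geometry has non-degenerate rank at least $2$. Then $q_1$ and $q_2$ are proportional: there is $\kappa\in K\setminus\{0\}$ such that $t^{\sigma_2}=\kappa t^{\sigma_1}\kappa^{-1}$ for all $t\in K$ and $\varepsilon_2=\kappa(\kappa^{\sigma_1})^{-1}\varepsilon_1$ (so that left multiplication by $\kappa$ induces a homomorphism $\overline{K}^{\sigma_1,\varepsilon_1}\to\overline{K}^{\sigma_2,\varepsilon_2}$), $\overline{R}_2=\kappa\overline{R}_1$, and $q_2(x)=\kappa q_1(x)$ for every $x\in V$. -/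

import Mathlib

open MulOpposite

/-! ### Point-line geometries -/

/-- A system of points and lines inside an ambient type `α`; a line is identified with the set of
its points. -/
@[ext]
structure PointLineGeometry (α : Type*) where
  /-- the set of points -/
  points : Set α
  /-- the set of lines -/
  lines : Set (Set α)

namespace PointLineGeometry

variable {α : Type*} (S : PointLineGeometry α)

/-- Two points are collinear if they are equal or joined by a line. -/
def Collinear (p r : α) : Prop := p = r ∨ ∃ l ∈ S.lines, p ∈ l ∧ r ∈ l

/-- A subspace: a set of points containing every line that meets it in at least two points. -/
def IsSubspace (X : Set α) : Prop :=
  X ⊆ S.points ∧ ∀ l ∈ S.lines, (l ∩ X).Nontrivial → l ⊆ X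

/-- A singular subspace: a subspace whose points are pairwise collinear
(the empty set is allowed). -/
def IsSingular (X : Set α) : Prop :=
  S.IsSubspace X ∧ ∀ p ∈ X, ∀ r ∈ X, S.Collinear p r

/-- The rank: the supremum of the lengths `n` of the chains `X₀ ⊂ X₁ ⊂ ⋯ ⊂ Xₙ` of singular
subspaces. (The empty subspace counts, so a single point has rank `1` and a projective line, as well
as a generalized quadrangle, has rank `2`.) -/
noncomputable def rank : WithBot ℕ∞ := Order.krullDim {X : Set α // S.IsSingular X}

/-- The radical: the set of the points that are collinear with all points. -/
def radical : Set α := {p | p ∈ S.points ∧ ∀ r ∈ S.points, S.Collinear p r}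

/-- The subspace generated by a set of points. -/
def span (Y : Set α) : Set α := ⋂₀ {X | S.IsSubspace X ∧ Y ⊆ X}

/-- The quotient of `S` over its radical `D`: its points are the subspaces `⟨D, p⟩` for the points
`p ∉ D`; its lines are the sets `{⟨D, p⟩ | p ∈ l}` for the lines `l` disjoint from `D`. -/
def quotientRadical : PointLineGeometry (Set α) where
  points := {X | ∃ p ∈ S.points, p ∉ S.radical ∧ X = S.span (S.radical ∪ {p})}
  lines := {m | ∃ l ∈ S.lines, Disjoint l S.radical ∧
    m = (fun p => S.span (S.radical ∪ {p})) '' l}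

/-- The non-degenerate rank: the rank of the quotient over the radical. -/
noncomputable def nondegenerateRank : WithBot ℕ∞ := S.quotientRadical.rank

end PointLineGeometry

/-! ### Admissible pairs -/

/-- An admissible pair `(σ, ε)` of a division ring `K`: an anti-automorphism `σ` of `K`, given as a
ring isomorphism onto the opposite ring, and `ε ∈ K` with `ε^σ ε = 1` and `t^(σ²) = ε t ε⁻¹`. -/
@[ext]
structure AdmissiblePair (K : Type*) [DivisionRing K] where
  /-- the anti-automorphism -/
  σ : K ≃+* Kᵐᵒᵖ
  /-- the scalar -/
  ε : K
  conj_mul_self : unop (σ ε) * ε = 1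
  conj_conj : ∀ t : K, unop (σ (unop (σ t))) = ε * t * ε⁻¹

namespace AdmissiblePair

variable {K : Type*} [DivisionRing K] (P : AdmissiblePair K)

/-- `t ↦ t^σ`, as a map from `K` to `K`. -/
def conj (t : K) : K := unop (P.σ t)

theorem conj_add (s t : K) : P.conj (s + t) = P.conj s + P.conj t := by simp [conj]

theorem conj_mul (s t : K) : P.conj (s * t) = P.conj t * P.conj s := by simp [conj]

theorem conj_ne_zero {t : K} (ht : t ≠ 0) : P.conj t ≠ 0 := by simpa [conj] using ht

theorem conj_sub (s t : K) : P.conj (s - t) = P.conj s - P.conj t := by simp [conj]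

theorem conj_inv (t : K) : P.conj t⁻¹ = (P.conj t)⁻¹ := by simp [conj]

theorem conj_conj' (t : K) : P.conj (P.conj t) = P.ε * t * P.ε⁻¹ := P.conj_conj t

theorem ε_ne_zero : P.ε ≠ 0 := fun h => by
  have := P.conj_mul_self
  rw [h, mul_zero] at this
  exact zero_ne_one this

/-- The subgroup `K_{σ,ε} = {t - t^σ ε | t ∈ K}` of the additive group of `K`. -/
def lowerSubgroup : AddSubgroup K :=
  AddMonoidHom.range
    (AddMonoidHom.mk' (fun t : K => t - P.conj t * P.ε) fun s t => by
      rw [conj_add, add_mul]; abel)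

theorem mem_lowerSubgroup {s : K} : s ∈ P.lowerSubgroup ↔ ∃ t : K, t - P.conj t * P.ε = s :=
  Iff.rfl

/-- The quotient group `K̄ = K / K_{σ,ε}`. -/
abbrev Kbar : Type _ := K ⧸ P.lowerSubgroup

/-- The map `t ↦ c^σ t c` on `K`. -/
def twist (c : K) : K →+ K := (AddMonoidHom.mulRight c).comp (AddMonoidHom.mulLeft (P.conj c))

@[simp]
theorem twist_apply (c t : K) : P.twist c t = P.conj c * t * c := rfl

theorem lowerSubgroup_le_comap_twist (c : K) :
    P.lowerSubgroup ≤ P.lowerSubgroup.comap (P.twist c) := by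
  rintro _ ⟨t, rfl⟩
  refine ⟨P.conj c * t * c, ?_⟩
  have h : P.ε⁻¹ * P.ε = 1 := inv_mul_cancel₀ P.ε_ne_zero
  simp only [AddMonoidHom.mk'_apply, twist_apply, conj_mul, conj_conj', mul_sub, sub_mul, mul_assoc,
    h, mul_one]

/-- The scalar multiplication `t̄ ∘ c`, the class of `c^σ t c`, on `K̄`. -/
def circ (c : K) : P.Kbar →+ P.Kbar :=
  QuotientAddGroup.map _ _ (P.twist c) (P.lowerSubgroup_le_comap_twist c)

/-- The admissible pair `κ · (σ, ε) = (σ', ε')`, where `t^σ' = κ t^σ κ⁻¹` and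
`ε' = κ (κ^σ)⁻¹ ε`. -/
def scale (κ : K) (hκ : κ ≠ 0) : AdmissiblePair K where
  σ :=
    { toFun := fun t => op (κ * P.conj t * κ⁻¹)
      invFun := fun t => P.σ.symm (op (κ⁻¹ * unop t * κ))
      left_inv := fun t => by simp [conj, mul_assoc, hκ]
      right_inv := fun t => by
        apply unop_injective
        simp [conj, mul_assoc, hκ]
      map_mul' := fun s t => by
        apply unop_injective
        simp [conj, mul_assoc, hκ]
      map_add' := fun s t => by
        apply unop_injective
        simp [conj, mul_add, add_mul] }
  ε := κ * (P.conj κ)⁻¹ * P.ε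
  conj_mul_self := by
    have h1 := P.conj_ne_zero hκ
    have h2 := P.ε_ne_zero
    have h3 : P.conj P.ε * P.ε = 1 := P.conj_mul_self
    have h4 : P.conj P.ε = P.ε⁻¹ := eq_inv_of_mul_eq_one_left h3
    change κ * P.conj (κ * (P.conj κ)⁻¹ * P.ε) * κ⁻¹ * (κ * (P.conj κ)⁻¹ * P.ε) = 1
    simp [conj_mul, conj_inv, conj_conj', h4, mul_assoc, hκ, h1, h2]
  conj_conj := fun t => by
    have h1 := P.conj_ne_zero hκ
    have h2 := P.ε_ne_zero
    change κ * P.conj (κ * P.conj t * κ⁻¹) * κ⁻¹ = _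
    simp [conj_mul, conj_inv, conj_conj', mul_assoc]

/-- A `∘`-closed subgroup of `K̄`. -/
structure ClosedSubgroup where
  /-- the underlying subgroup -/
  carrier : AddSubgroup P.Kbar
  circ_mem : ∀ c : K, ∀ r ∈ carrier, P.circ c r ∈ carrier

/-- The scalar multiplication induced by `∘` on `K̄ / R̄`, for a closed subgroup `R̄`. -/
def ClosedSubgroup.circ {P : AdmissiblePair K} (R : P.ClosedSubgroup) (c : K) :
    P.Kbar ⧸ R.carrier →+ P.Kbar ⧸ R.carrier :=
  QuotientAddGroup.map _ _ (P.circ c) (R.circ_mem c)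

theorem lowerSubgroup_le_comap_mulLeft {P Q : AdmissiblePair K} {κ : K} {hκ : κ ≠ 0}
    (h : Q = P.scale κ hκ) :
    P.lowerSubgroup ≤ Q.lowerSubgroup.comap (AddMonoidHom.mulLeft κ) := by
  subst h
  rintro _ ⟨t, rfl⟩
  refine ⟨κ * t, ?_⟩
  have h1 := P.conj_ne_zero hκ
  change κ * t - κ * P.conj (κ * t) * κ⁻¹ * (κ * (P.conj κ)⁻¹ * P.ε) = κ * (t - P.conj t * P.ε)
  simp [conj_mul, mul_assoc, hκ, h1, mul_sub]

/-- If `(σ', ε') = κ · (σ, ε)`, the homomorphism `K / K_{σ,ε} → K / K_{σ',ε'}` induced by left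
multiplication by `κ`. -/
def mulLeftBar {P Q : AdmissiblePair K} {κ : K} {hκ : κ ≠ 0} (h : Q = P.scale κ hκ) :
    P.Kbar →+ Q.Kbar :=
  QuotientAddGroup.map _ _ (AddMonoidHom.mulLeft κ) (lowerSubgroup_le_comap_mulLeft h)

/-- If moreover `R̄' = κ R̄`, the induced homomorphism between the quotients by `R̄` and `R̄'`. -/
def mulLeftQuot {P Q : AdmissiblePair K} {κ : K} {hκ : κ ≠ 0} (h : Q = P.scale κ hκ)
    {R : P.ClosedSubgroup} {R' : Q.ClosedSubgroup}
    (hR : R'.carrier = R.carrier.map (mulLeftBar h)) :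
    P.Kbar ⧸ R.carrier →+ Q.Kbar ⧸ R'.carrier :=
  QuotientAddGroup.map _ _ (mulLeftBar h) (hR ▸ AddSubgroup.le_comap_map _ _)

/-- The class in `K̄ / R̄` of an element of `K`. -/
def ClosedSubgroup.cls {P : AdmissiblePair K} (R : P.ClosedSubgroup) (t : K) :
    P.Kbar ⧸ R.carrier :=
  QuotientAddGroup.mk (QuotientAddGroup.mk t : P.Kbar)

end AdmissiblePair

/-! ### Sesquilinear forms and generalized pseudo-quadratic forms

`V` is a right vector space over `K`, that is a module over `Kᵐᵒᵖ`; the vector `x c` is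
`op c • x`. -/

section Forms

variable {K : Type*} [DivisionRing K] {V : Type*} [AddCommGroup V] [Module Kᵐᵒᵖ V]

/-- `f` is a trace-valued `(σ, ε)`-sesquilinear form on the right vector space `V`. -/
structure IsTraceValuedForm (P : AdmissiblePair K) (f : V → V → K) : Prop where
  add_left : ∀ x x' y, f (x + x') y = f x y + f x' y
  add_right : ∀ x y y', f x (y + y') = f x y + f x y'
  smul_smul : ∀ (x y : V) (c d : K), f (op c • x) (op d • y) = P.conj c * f x y * d
  reflexive : ∀ x y, f y x = P.conj (f x y) * P.ε
  trace_valued : ∀ x, ∃ t : K, f x x = t + P.conj t * P.ε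

/-- A generalized `(σ, ε)`-quadratic form `q : V → K̄ / R̄` with co-defect `R̄`. -/
structure GenQuadraticForm (P : AdmissiblePair K) (R : P.ClosedSubgroup) (V : Type*)
    [AddCommGroup V] [Module Kᵐᵒᵖ V] where
  /-- the underlying map -/
  toFun : V → P.Kbar ⧸ R.carrier
  map_smul : ∀ (x : V) (c : K), toFun (op c • x) = R.circ c (toFun x)
  exists_sesquilinearization : ∃ f : V → V → K, IsTraceValuedForm P f ∧
    ∀ x y, toFun (x + y) = toFun x + toFun y + R.cls (f x y)

/-- The points and lines of `PG(V)` on which `q` vanishes. -/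
def GenQuadraticForm.polarSpace {P : AdmissiblePair K} {R : P.ClosedSubgroup}
    (q : GenQuadraticForm P R V) : PointLineGeometry (Projectivization Kᵐᵒᵖ V) where
  points := {p | ∀ v ∈ p.submodule, q.toFun v = 0}
  lines := {l | ∃ W : Submodule Kᵐᵒᵖ V, Module.finrank Kᵐᵒᵖ W = 2 ∧
    (∀ v ∈ W, q.toFun v = 0) ∧ l = {p | p.submodule ≤ W}}

/-- `q₂ = κ q₁` for some nonzero scalar `κ`: the admissible pairs, the co-defects and the values
are all scaled by `κ`. -/
def GenQuadraticForm.Proportional {P₁ P₂ : AdmissiblePair K}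
    {R₁ : P₁.ClosedSubgroup} {R₂ : P₂.ClosedSubgroup}
    (q₁ : GenQuadraticForm P₁ R₁ V) (q₂ : GenQuadraticForm P₂ R₂ V) : Prop :=
  ∃ (κ : K) (hκ : κ ≠ 0) (hP : P₂ = P₁.scale κ hκ)
    (hR : R₂.carrier = R₁.carrier.map (AdmissiblePair.mulLeftBar hP)),
    ∀ x : V, q₂.toFun x = AdmissiblePair.mulLeftQuot hP hR (q₁.toFun x)

end Forms

/-! For singular `x`, `y` and a proper co-defect, `B x y = 0` exactly when every `x + yλ` is
singular, because a nonzero right ideal of `K` is all of `K`. So `S_q` determines perpendicularity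
of singular vectors.

If `a` is singular and `a^⊥` contains a hyperbolic pair, `a^⊥` is generated additively by singular
vectors (`le_of_hyperbolic_mem`). Hence `B₁ a` and `B₂ a` differ by a left factor (`exists_eq_mul`).
Rank at least 2 supplies two orthogonal hyperbolic pairs (`exists_hyperbolicQuadruple`). Comparing
the factors of `e`, `c` and `et + c` shows that they agree and relates `σ₂` to `σ₁` (`conj_mul_eq`).
Reflexivity then gives `ε₂`, and generation by singular vectors gives `B₂ = κB₁` (`exists_scale`).

Finally `q₂ - κq₁` is additive and vanishes on the singular vectors, which generate `V`
(`proportional`). -/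

namespace AdmissiblePair.ClosedSubgroup

variable {K : Type*} [DivisionRing K] {P : AdmissiblePair K} (R : P.ClosedSubgroup)

theorem cls_add (s t : K) : R.cls (s + t) = R.cls s + R.cls t := rfl

theorem cls_zero : R.cls 0 = 0 := rfl

theorem circ_cls (c t : K) : R.circ c (R.cls t) = R.cls (P.conj c * t * c) := rfl

theorem cls_surjective : Function.Surjective R.cls := by
  intro z
  obtain ⟨y, rfl⟩ := QuotientAddGroup.mk_surjective z
  obtain ⟨t, rfl⟩ := QuotientAddGroup.mk_surjective y
  exact ⟨t, rfl⟩

theorem cls_eq_zero_iff (t : K) :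
    R.cls t = 0 ↔ (QuotientAddGroup.mk t : P.Kbar) ∈ R.carrier :=
  QuotientAddGroup.eq_zero_iff _

/-- A right ideal contained in a proper co-defect is zero. -/
theorem eq_zero_of_forall_cls_mul {s : K} (hR : ∃ t, R.cls t ≠ 0)
    (h : ∀ c, R.cls (s * c) = 0) : s = 0 := by
  by_contra hs
  obtain ⟨t, ht⟩ := hR
  apply ht
  have := h (s⁻¹ * t)
  rwa [mul_inv_cancel_left₀ hs] at this

end AdmissiblePair.ClosedSubgroup

/-! ### Rules for sesquilinear forms. -/

namespace IsTraceValuedForm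

variable {K : Type*} [DivisionRing K] {V : Type*} [AddCommGroup V] [Module Kᵐᵒᵖ V]
  {P : AdmissiblePair K} {B : V → V → K} (hB : IsTraceValuedForm P B)

include hB

theorem smul_right (x y : V) (d : K) : B x (op d • y) = B x y * d := by
  have := hB.smul_smul x y 1 d
  simpa [AdmissiblePair.conj] using this

theorem smul_left (x y : V) (c : K) : B (op c • x) y = P.conj c * B x y := by
  have := hB.smul_smul x y c 1
  simpa using this

theorem zero_right (x : V) : B x 0 = 0 := by
  have := hB.add_right x 0 0
  simpa using this

theorem zero_left (x : V) : B 0 x = 0 := by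
  have := hB.add_left 0 0 x
  simpa using this

theorem neg_right (x y : V) : B x (-y) = -B x y := by
  have := hB.add_right x y (-y)
  rw [add_neg_cancel, hB.zero_right] at this
  exact (neg_eq_of_add_eq_zero_right this.symm).symm

theorem neg_left (x y : V) : B (-x) y = -B x y := by
  have := hB.add_left x (-x) y
  rw [add_neg_cancel, hB.zero_left] at this
  exact (neg_eq_of_add_eq_zero_right this.symm).symm

theorem sub_right (x y z : V) : B x (y - z) = B x y - B x z := by
  rw [sub_eq_add_neg, hB.add_right, hB.neg_right, sub_eq_add_neg]

theorem eq_zero_swap {x y : V} (h : B x y = 0) : B y x = 0 := by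
  rw [hB.reflexive x y, h]
  simp [AdmissiblePair.conj]

theorem ne_zero_swap {x y : V} (h : B x y ≠ 0) : B y x ≠ 0 :=
  fun h' => h (hB.eq_zero_swap h')

end IsTraceValuedForm

/-! ### Singular vectors and the polar form. -/

namespace GenQuadraticForm

variable {K : Type*} [DivisionRing K] {V : Type*} [AddCommGroup V] [Module Kᵐᵒᵖ V]

/-- `B` is a sesquilinearization of `q`, and the co-defect of `q` is proper. -/
structure IsPolarForm {P : AdmissiblePair K} {R : P.ClosedSubgroup} (q : GenQuadraticForm P R V)
    (B : V → V → K) : Prop where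
  form : IsTraceValuedForm P B
  map_add : ∀ x y, q.toFun (x + y) = q.toFun x + q.toFun y + R.cls (B x y)
  proper : ∃ t, R.cls t ≠ 0

section Basic

variable {P : AdmissiblePair K} {R : P.ClosedSubgroup} (q : GenQuadraticForm P R V)

theorem map_zero : q.toFun 0 = 0 := by
  have h := q.map_smul 0 0
  obtain ⟨t, ht⟩ := R.cls_surjective (q.toFun 0)
  rw [smul_zero, ← ht, R.circ_cls, mul_zero, R.cls_zero, ht] at h
  exact h

theorem map_smul_eq_zero {x : V} (hx : q.toFun x = 0) (c : K) : q.toFun (op c • x) = 0 := by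
  rw [q.map_smul, hx, _root_.map_zero]

/-- A nonzero value makes the co-defect proper; with an improper one every vector is singular and
`B` leaves no trace in the geometry. -/
theorem exists_isPolarForm {v : V} (hv : q.toFun v ≠ 0) : ∃ B, q.IsPolarForm B := by
  obtain ⟨B, hB, hq⟩ := q.exists_sesquilinearization
  obtain ⟨t, ht⟩ := R.cls_surjective (q.toFun v)
  exact ⟨B, hB, hq, t, by rwa [ht]⟩

theorem mem_points_iff (p : Projectivization Kᵐᵒᵖ V) :
    p ∈ q.polarSpace.points ↔ q.toFun p.rep = 0 := by
  constructor
  · intro h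
    exact h _ (by rw [Projectivization.submodule_eq]; exact Submodule.mem_span_singleton_self _)
  · intro h v hv
    rw [Projectivization.submodule_eq, Submodule.mem_span_singleton] at hv
    obtain ⟨c, rfl⟩ := hv
    exact q.map_smul_eq_zero h c.unop

theorem mk_mem_points_iff {v : V} (hv : v ≠ 0) :
    Projectivization.mk Kᵐᵒᵖ v hv ∈ q.polarSpace.points ↔ q.toFun v = 0 := by
  constructor
  · intro h
    exact h v (by rw [Projectivization.submodule_mk]; exact Submodule.mem_span_singleton_self v)
  · intro h w hw
    rw [Projectivization.submodule_mk, Submodule.mem_span_singleton] at hw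
    obtain ⟨c, rfl⟩ := hw
    exact q.map_smul_eq_zero h c.unop

end Basic

namespace IsPolarForm

variable {P : AdmissiblePair K} {R : P.ClosedSubgroup} {q : GenQuadraticForm P R V}
  {B : V → V → K} (hB : q.IsPolarForm B)

include hB

theorem map_add_of_right {x y : V} (hy : q.toFun y = 0) :
    q.toFun (x + y) = q.toFun x + R.cls (B x y) := by
  rw [hB.map_add, hy]
  abel

theorem map_add_of_singular {x y : V} (hx : q.toFun x = 0) (hy : q.toFun y = 0) :
    q.toFun (x + y) = R.cls (B x y) := by
  rw [hB.map_add, hx, hy]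
  abel

theorem map_add_eq_zero {x y : V} (hx : q.toFun x = 0) (hy : q.toFun y = 0) (h : B x y = 0) :
    q.toFun (x + y) = 0 := by
  rw [hB.map_add_of_singular hx hy, h, R.cls_zero]

/-- The right ideal `B x y * K` lies in the preimage of a proper co-defect. This recovers
perpendicularity from singularity alone. -/
theorem eq_zero_of_forall {x y : V} (hx : q.toFun x = 0) (hy : q.toFun y = 0)
    (h : ∀ c : K, q.toFun (x + op c • y) = 0) : B x y = 0 := by
  apply R.eq_zero_of_forall_cls_mul hB.proper
  intro c
  have := h c
  rwa [hB.map_add_of_singular hx (q.map_smul_eq_zero hy c), hB.form.smul_right] at this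

theorem self_eq_zero {x : V} (hx : q.toFun x = 0) : B x x = 0 := by
  refine hB.eq_zero_of_forall hx hx fun c => ?_
  have := q.map_smul_eq_zero hx (1 + c)
  rwa [op_add, add_smul, op_one, one_smul] at this

/-- The line through `u` and a singular point `c` not perpendicular to `u` meets the quadric in a
second point. -/
theorem exists_singular_add_smul {u c : V} (hc : q.toFun c = 0) (huc : B u c ≠ 0) :
    ∃ a : K, q.toFun (u + op a • c) = 0 := by
  obtain ⟨t, ht⟩ := R.cls_surjective (q.toFun u)
  refine ⟨-((B u c)⁻¹ * t), ?_⟩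
  rw [hB.map_add_of_right (q.map_smul_eq_zero hc _), hB.form.smul_right, mul_neg,
    mul_inv_cancel_left₀ huc, ← ht, ← R.cls_add, add_neg_cancel, R.cls_zero]

/-- A subgroup `W` containing a hyperbolic pair `c, d` is generated by the multiples of `c`, by `d`
and by the singular vectors of `W` not perpendicular to `c`. -/
theorem le_of_hyperbolic_mem (W G : AddSubgroup V) {c d : V} (hc : q.toFun c = 0)
    (hcd : B d c ≠ 0) (hcW : ∀ a : K, op a • c ∈ W) (hdW : d ∈ W)
    (hcG : ∀ a : K, op a • c ∈ G) (hdG : d ∈ G)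
    (hG : ∀ w ∈ W, q.toFun w = 0 → B w c ≠ 0 → w ∈ G) : W ≤ G := by
  have key : ∀ u ∈ W, B u c ≠ 0 → u ∈ G := by
    -- Adding a multiple of `c` makes `u` singular without changing `B u c`; below, a vector
    -- perpendicular to `c` is first shifted by `d`.
    intro u hu huc
    obtain ⟨a, ha⟩ := hB.exists_singular_add_smul hc huc
    have h1 : B (u + op a • c) c ≠ 0 := by
      rwa [hB.form.add_left, hB.form.smul_left, hB.self_eq_zero hc, mul_zero, add_zero]
    exact (AddSubgroup.add_mem_cancel_right G (hcG a)).1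
      (hG _ (W.add_mem hu (hcW a)) ha h1)
  intro u hu
  by_cases huc : B u c = 0
  · refine (AddSubgroup.add_mem_cancel_right G hdG).1 (key _ (W.add_mem hu hdW) ?_)
    rwa [hB.form.add_left, huc, zero_add]
  · exact key u hu huc

end IsPolarForm

/-! ### Orthogonal hyperbolic pairs from the rank. -/

section Hyperbolic

/-- Two mutually orthogonal hyperbolic pairs `e, f` and `c, d`. -/
structure IsHyperbolicQuadruple {P : AdmissiblePair K} {R : P.ClosedSubgroup}
    (q : GenQuadraticForm P R V) (B : V → V → K) (e f c d : V) : Prop where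
  e_sing : q.toFun e = 0
  f_sing : q.toFun f = 0
  c_sing : q.toFun c = 0
  d_sing : q.toFun d = 0
  ef : B e f ≠ 0
  cd : B c d ≠ 0
  ec : B e c = 0
  ed : B e d = 0
  fc : B f c = 0
  fd : B f d = 0

variable {P : AdmissiblePair K} {R : P.ClosedSubgroup} {q : GenQuadraticForm P R V}
  {B : V → V → K}

theorem IsHyperbolicQuadruple.swap (hB : q.IsPolarForm B) {e f c d : V}
    (h : IsHyperbolicQuadruple q B e f c d) : IsHyperbolicQuadruple q B f e c d :=
  ⟨h.f_sing, h.e_sing, h.c_sing, h.d_sing, hB.form.ne_zero_swap h.ef, h.cd, h.fc, h.fd, h.ec,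
    h.ed⟩

theorem IsHyperbolicQuadruple.exchange (hB : q.IsPolarForm B) {e f c d : V}
    (h : IsHyperbolicQuadruple q B e f c d) : IsHyperbolicQuadruple q B c d e f :=
  ⟨h.c_sing, h.d_sing, h.e_sing, h.f_sing, h.cd, h.ef, hB.form.eq_zero_swap h.ec,
    hB.form.eq_zero_swap h.fc, hB.form.eq_zero_swap h.ed, hB.form.eq_zero_swap h.fd⟩

/-- The top of a chain of length 2 of singular subspaces has two distinct points; the line joining
them in the quotient comes from a line missing the radical. -/
theorem exists_line_disjoint_radical {α : Type*} (S : PointLineGeometry α)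
    (h : 2 ≤ S.nondegenerateRank) : ∃ l ∈ S.lines, Disjoint l S.radical := by
  have h' : ((2 : ℕ) : WithBot ℕ∞) ≤ Order.krullDim {X // S.quotientRadical.IsSingular X} := h
  obtain ⟨s, hs⟩ := Order.le_krullDim_iff.1 h'
  have h01 : (s ⟨0, by omega⟩).1 ⊂ (s ⟨1, by omega⟩).1 := s.strictMono (by simp [Fin.lt_def])
  have h12 : (s ⟨1, by omega⟩).1 ⊂ (s ⟨2, by omega⟩).1 := s.strictMono (by simp [Fin.lt_def])
  obtain ⟨a, ha, -⟩ := Set.exists_of_ssubset h01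
  obtain ⟨b, hb, hb'⟩ := Set.exists_of_ssubset h12
  rcases (s ⟨2, by omega⟩).2.2 a (h12.subset ha) b hb with rfl | ⟨m, ⟨l, hl, hd, -⟩, -⟩
  · exact absurd ha hb'
  · exact ⟨l, hl, hd⟩

/-- A point of a singular line disjoint from the radical is not collinear with all points. -/
theorem exists_nonsingular_add {W : Submodule Kᵐᵒᵖ V} (hW : ∀ v ∈ W, q.toFun v = 0)
    (hd : Disjoint {p : Projectivization Kᵐᵒᵖ V | p.submodule ≤ W} q.polarSpace.radical)
    {x : V} (hx : x ∈ W) (hx0 : x ≠ 0) :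
    ∃ y, q.toFun y = 0 ∧ ∃ v ∈ Submodule.span Kᵐᵒᵖ {x, y}, q.toFun v ≠ 0 := by
  have hp : Projectivization.mk Kᵐᵒᵖ x hx0 ∉ q.polarSpace.radical := by
    refine Set.disjoint_left.1 hd ?_
    change (Projectivization.mk Kᵐᵒᵖ x hx0).submodule ≤ W
    rw [Projectivization.submodule_mk, Submodule.span_singleton_le_iff_mem]
    exact hx
  have hxp := (q.mk_mem_points_iff hx0).2 (hW x hx)
  simp only [PointLineGeometry.radical, Set.mem_ofPred_eq, hxp, true_and, not_forall] at hp
  obtain ⟨r, hr, hpr⟩ := hp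
  have hne : Projectivization.mk Kᵐᵒᵖ x hx0 ≠ r := fun h => hpr (Or.inl h)
  refine ⟨r.rep, (q.mem_points_iff r).1 hr, ?_⟩
  by_contra! hall
  apply hpr
  refine Or.inr ⟨_, ⟨Submodule.span Kᵐᵒᵖ {x, r.rep}, ?_, hall, rfl⟩, ?_, ?_⟩
  · have hli : LinearIndependent Kᵐᵒᵖ ![x, r.rep] := by
      rw [LinearIndependent.pair_iff' hx0]
      intro a ha
      apply hne
      rw [← r.mk_rep, Projectivization.mk_eq_mk_iff']
      have ha0 : a ≠ 0 := by
        rintro rfl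
        exact r.rep_nonzero (by rw [← ha, zero_smul])
      exact ⟨a⁻¹, by rw [← ha, inv_smul_smul₀ ha0]⟩
    have := finrank_span_eq_card hli
    rwa [Matrix.range_cons, Matrix.range_cons, Matrix.range_empty, Set.union_empty,
      Set.singleton_union, Fintype.card_fin] at this
  · change (Projectivization.mk Kᵐᵒᵖ x hx0).submodule ≤ _
    rw [Projectivization.submodule_mk, Submodule.span_singleton_le_iff_mem]
    exact Submodule.subset_span (by simp)
  · change r.submodule ≤ _
    rw [Projectivization.submodule_eq, Submodule.span_singleton_le_iff_mem]
    exact Submodule.subset_span (by simp)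

theorem IsPolarForm.ne_zero_of_mem_span (hB : q.IsPolarForm B) {x y v : V} (hx : q.toFun x = 0)
    (hy : q.toFun y = 0) (hv : v ∈ Submodule.span Kᵐᵒᵖ {x, y}) (hqv : q.toFun v ≠ 0) :
    B x y ≠ 0 := by
  intro h
  obtain ⟨a, b, rfl⟩ := Submodule.mem_span_pair.1 hv
  refine hqv (hB.map_add_eq_zero (q.map_smul_eq_zero hx a.unop) (q.map_smul_eq_zero hy b.unop) ?_)
  have := hB.form.smul_smul x y a.unop b.unop
  rwa [h, mul_zero, zero_mul] at this

/-- If the non-degenerate rank is at least two, there are two mutually orthogonal hyperbolic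
pairs. -/
theorem exists_hyperbolicQuadruple (h : 2 ≤ q.polarSpace.nondegenerateRank) :
    ∃ B e f c d, q.IsPolarForm B ∧ IsHyperbolicQuadruple q B e f c d := by
  obtain ⟨l, ⟨W, hW2, hW, rfl⟩, hd⟩ := exists_line_disjoint_radical _ h
  have hWpos : 0 < Module.finrank Kᵐᵒᵖ W := by omega
  have := Module.finite_of_finrank_pos hWpos
  obtain ⟨e', he'⟩ := Module.finrank_pos_iff_exists_ne_zero.1 hWpos
  obtain ⟨e, heW⟩ := e'
  have he0 : e ≠ 0 := fun h => he' (Subtype.ext h)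
  have he := hW e heW
  obtain ⟨f, hf, v, hv, hqv⟩ := exists_nonsingular_add hW hd heW he0
  obtain ⟨B, hB⟩ := q.exists_isPolarForm hqv
  have hef := hB.ne_zero_of_mem_span he hf hv hqv
  have hfe := hB.form.ne_zero_swap hef
  obtain ⟨c', hc'⟩ : ∃ c' : W, ∀ a : Kᵐᵒᵖ, a • (⟨e, heW⟩ : W) ≠ c' := by
    by_contra! hall
    have := finrank_le_one (⟨e, heW⟩ : W) hall
    omega
  obtain ⟨c₀, hc₀W⟩ := c'
  have hperp : ∀ x ∈ W, ∀ y ∈ W, B x y = 0 := fun x hx y hy =>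
    hB.eq_zero_of_forall (hW x hx) (hW y hy) fun a => hW _ (W.add_mem hx (W.smul_mem _ hy))
  -- Projection of `c₀` along `e` into `f^⊥`; it stays in `W` and is nonzero since `c₀` is not a
  -- multiple of `e`.
  obtain ⟨c, hc⟩ : ∃ c, c = c₀ - op ((B f e)⁻¹ * B f c₀) • e := ⟨_, rfl⟩
  have hcW : c ∈ W := hc ▸ W.sub_mem hc₀W (W.smul_mem _ heW)
  have hc0 : c ≠ 0 := by
    intro h0
    rw [h0] at hc
    exact hc' _ (Subtype.ext (sub_eq_zero.1 hc.symm).symm)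
  have hfc : B f c = 0 := by
    rw [hc, hB.form.sub_right, hB.form.smul_right, mul_inv_cancel_left₀ hfe, sub_self]
  obtain ⟨z, hz, w, hw, hqw⟩ := exists_nonsingular_add hW hd hcW hc0
  have hcz := hB.ne_zero_of_mem_span (hW c hcW) hz hw hqw
  have hec := hperp e heW c hcW
  -- Projection of `z` to `{e, f}^⊥`. It may cease to be singular; a multiple of `c` repairs this
  -- without disturbing any of the products required.
  obtain ⟨z', hz'⟩ : ∃ z', z' = z - op ((B e f)⁻¹ * B e z) • f - op ((B f e)⁻¹ * B f z) • e :=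
    ⟨_, rfl⟩
  have hez' : B e z' = 0 := by
    rw [hz']
    simp only [hB.form.sub_right, hB.form.smul_right, hB.self_eq_zero he]
    rw [mul_inv_cancel_left₀ hef, zero_mul, sub_self, sub_zero]
  have hfz' : B f z' = 0 := by
    rw [hz']
    simp only [hB.form.sub_right, hB.form.smul_right, hB.self_eq_zero hf]
    rw [mul_inv_cancel_left₀ hfe, zero_mul, sub_zero, sub_self]
  have hcz' : B c z' = B c z := by
    rw [hz']
    simp only [hB.form.sub_right, hB.form.smul_right, hB.form.eq_zero_swap hfc,
      hB.form.eq_zero_swap hec, zero_mul, sub_zero]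
  obtain ⟨a, ha⟩ := hB.exists_singular_add_smul (u := z') (hW c hcW)
    (hB.form.ne_zero_swap (hcz'.symm ▸ hcz))
  refine ⟨B, e, f, c, z' + op a • c, hB, he, hf, hW c hcW, ha, hef, ?_, hec, ?_, hfc, ?_⟩
  · rwa [hB.form.add_right, hB.form.smul_right, hperp c hcW c hcW, zero_mul, add_zero, hcz']
  · rw [hB.form.add_right, hB.form.smul_right, hez', hec, zero_mul, add_zero]
  · rw [hB.form.add_right, hB.form.smul_right, hfz', hfc, zero_mul, add_zero]

end Hyperbolic

/-! ### Comparison of two forms with the same singular vectors. -/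

section Comparison

variable {P₁ P₂ : AdmissiblePair K} {R₁ : P₁.ClosedSubgroup} {R₂ : P₂.ClosedSubgroup}
  {q₁ : GenQuadraticForm P₁ R₁ V} {q₂ : GenQuadraticForm P₂ R₂ V}
  {B₁ B₂ : V → V → K}

theorem eq_zero_iff_of_polarSpace_eq (hS : q₁.polarSpace = q₂.polarSpace) (v : V) :
    q₁.toFun v = 0 ↔ q₂.toFun v = 0 := by
  by_cases hv : v = 0
  · rw [hv, q₁.map_zero, q₂.map_zero]
    simp
  · rw [← q₁.mk_mem_points_iff hv, ← q₂.mk_mem_points_iff hv, hS]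

theorem IsPolarForm.perp_of_perp (hB₁ : q₁.IsPolarForm B₁) (hB₂ : q₂.IsPolarForm B₂)
    (hQ : ∀ v, q₁.toFun v = 0 ↔ q₂.toFun v = 0) {x y : V} (hx : q₁.toFun x = 0)
    (hy : q₁.toFun y = 0) (h : B₁ x y = 0) : B₂ x y = 0 := by
  refine hB₂.eq_zero_of_forall ((hQ x).1 hx) ((hQ y).1 hy) fun c => (hQ _).1 ?_
  refine hB₁.map_add_eq_zero hx (q₁.map_smul_eq_zero hy c) ?_
  rw [hB₁.form.smul_right, h, zero_mul]

/-- The functionals defined by a singular vector `a` are proportional if `a` is perpendicular to a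
hyperbolic pair. -/
theorem IsPolarForm.exists_eq_mul (hB₁ : q₁.IsPolarForm B₁) (hB₂ : q₂.IsPolarForm B₂)
    (hQ : ∀ v, q₁.toFun v = 0 ↔ q₂.toFun v = 0) {a b c d : V} (ha : q₁.toFun a = 0)
    (hc : q₁.toFun c = 0) (hd : q₁.toFun d = 0) (hab : B₁ a b ≠ 0) (hac : B₁ a c = 0)
    (had : B₁ a d = 0) (hcd : B₁ c d ≠ 0) : ∃ κ, ∀ v, B₂ a v = κ * B₁ a v := by
  let f₁ : V →+ K := AddMonoidHom.mk' (B₁ a) (hB₁.form.add_right a)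
  let f₂ : V →+ K := AddMonoidHom.mk' (B₂ a) (hB₂.form.add_right a)
  have hle : f₁.ker ≤ f₂.ker := by
    have hcW : ∀ t : K, B₁ a (op t • c) = 0 := fun t => by
      rw [hB₁.form.smul_right, hac, zero_mul]
    refine hB₁.le_of_hyperbolic_mem _ _ hc (hB₁.form.ne_zero_swap hcd) hcW had ?_ ?_ ?_
    · exact fun t => hB₁.perp_of_perp hB₂ hQ ha (q₁.map_smul_eq_zero hc t) (hcW t)
    · exact hB₁.perp_of_perp hB₂ hQ ha hd had
    · exact fun w hw hqw _ => hB₁.perp_of_perp hB₂ hQ ha hqw hw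
  refine ⟨B₂ a b * (B₁ a b)⁻¹, fun v => ?_⟩
  have h1 : v - op ((B₁ a b)⁻¹ * B₁ a v) • b ∈ f₁.ker := by
    change B₁ a _ = 0
    rw [hB₁.form.sub_right, hB₁.form.smul_right, mul_inv_cancel_left₀ hab, sub_self]
  have h2 : B₂ a _ = 0 := hle h1
  rw [hB₂.form.sub_right, hB₂.form.smul_right, sub_eq_zero] at h2
  rw [h2, mul_assoc]

/-- The singular vector `et + c` has a factor `ν` of its own: evaluation at `d` gives `ν = μ`, and
evaluation at `f` then gives the identity. -/
theorem IsPolarForm.conj_mul_eq (hB₁ : q₁.IsPolarForm B₁) (hB₂ : q₂.IsPolarForm B₂)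
    (hQ : ∀ v, q₁.toFun v = 0 ↔ q₂.toFun v = 0) {e f c d : V}
    (h : IsHyperbolicQuadruple q₁ B₁ e f c d) {κ μ : K} (hκ : ∀ v, B₂ e v = κ * B₁ e v)
    (hμ : ∀ v, B₂ c v = μ * B₁ c v) (t : K) : P₂.conj t * κ = μ * P₁.conj t := by
  have hF := hB₁.form
  have hce := hF.eq_zero_swap h.ec
  have hcf := hF.eq_zero_swap h.fc
  have hdf := hF.eq_zero_swap h.fd
  have hsing : q₁.toFun (op t • e + c) = 0 :=
    hB₁.map_add_eq_zero (q₁.map_smul_eq_zero h.e_sing t) h.c_sing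
      (by rw [hF.smul_left, h.ec, mul_zero])
  -- Chosen so that `f + ds` is perpendicular to `et + c`; with `e` it forms the hyperbolic pair
  -- that `exists_eq_mul` needs.
  obtain ⟨s, hs⟩ : ∃ s, B₁ c d * s = -(P₁.conj t * B₁ e f) :=
    ⟨(B₁ c d)⁻¹ * _, mul_inv_cancel_left₀ h.cd _⟩
  have hf' : q₁.toFun (f + op s • d) = 0 :=
    hB₁.map_add_eq_zero h.f_sing (q₁.map_smul_eq_zero h.d_sing s)
      (by rw [hF.smul_right, h.fd, zero_mul])
  obtain ⟨ν, hν⟩ := hB₁.exists_eq_mul hB₂ hQ (a := op t • e + c) (b := d) (c := e)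
    (d := f + op s • d) hsing h.e_sing hf'
    (by rw [hF.add_left, hF.smul_left, h.ed, mul_zero, zero_add]; exact h.cd)
    (by rw [hF.add_left, hF.smul_left, hB₁.self_eq_zero h.e_sing, hce, mul_zero, zero_add])
    (by rw [hF.add_left, hF.smul_left, hF.add_right, hF.add_right, hF.smul_right, hF.smul_right,
          h.ed, hcf, hs, zero_mul, add_zero, zero_add, add_neg_cancel])
    (by rw [hF.add_right, hF.smul_right, h.ed, zero_mul, add_zero]; exact h.ef)
  have h1 := hν d
  have h2 := hν f
  rw [hB₂.form.add_left, hB₂.form.smul_left, hF.add_left, hF.smul_left, hκ, hμ] at h1 h2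
  rw [h.ed, mul_zero, mul_zero, mul_zero, zero_add, zero_add] at h1
  rw [hcf, mul_zero, add_zero, add_zero, ← mul_assoc, ← mul_assoc] at h2
  rw [mul_right_cancel₀ h.cd h1]
  exact mul_right_cancel₀ h.ef h2

/-- Polar forms of quadratic forms with the same singular vectors are proportional. -/
theorem IsPolarForm.exists_scale (hB₁ : q₁.IsPolarForm B₁) (hB₂ : q₂.IsPolarForm B₂)
    (hQ : ∀ v, q₁.toFun v = 0 ↔ q₂.toFun v = 0) {e f c d : V}
    (h : IsHyperbolicQuadruple q₁ B₁ e f c d) :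
    ∃ (κ : K) (hκ : κ ≠ 0), P₂ = P₁.scale κ hκ ∧ ∀ x y, B₂ x y = κ * B₁ x y := by
  have hF := hB₁.form
  have hG := hB₂.form
  have h' := h.exchange hB₁
  obtain ⟨κ, he⟩ := hB₁.exists_eq_mul hB₂ hQ h.e_sing h.c_sing h.d_sing h.ef h.ec h.ed h.cd
  obtain ⟨μ, hc⟩ := hB₁.exists_eq_mul hB₂ hQ h.c_sing h.e_sing h.f_sing h.cd h'.ec h'.ed h.ef
  obtain ⟨ν, hf⟩ := hB₁.exists_eq_mul hB₂ hQ h.f_sing h.c_sing h.d_sing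
    (hF.ne_zero_swap h.ef) h.fc h.fd h.cd
  obtain ⟨ρ, hd⟩ := hB₁.exists_eq_mul hB₂ hQ h.d_sing h.e_sing h.f_sing
    (hF.ne_zero_swap h.cd) h'.fc h'.fd h.ef
  have hconj1 : ∀ P : AdmissiblePair K, P.conj 1 = 1 := fun P => by simp [AdmissiblePair.conj]
  have hμ := hB₁.conj_mul_eq hB₂ hQ h he hc
  have eμ : κ = μ := by simpa [hconj1] using hμ 1
  subst eμ
  have eν : ν = κ := by simpa [hconj1] using hB₁.conj_mul_eq hB₂ hQ (h.swap hB₁) hf hc 1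
  have eρ : ρ = κ := by simpa [hconj1] using hB₁.conj_mul_eq hB₂ hQ (h'.swap hB₁) hd he 1
  rw [eν] at hf
  rw [eρ] at hd
  have hκ : κ ≠ 0 := by
    rintro rfl
    apply h.ef
    refine hB₂.perp_of_perp hB₁ (fun v => (hQ v).symm) ((hQ e).1 h.e_sing) ((hQ f).1 h.f_sing) ?_
    rw [he, zero_mul]
  have hκ' := P₁.conj_ne_zero hκ
  have hσ : ∀ t, P₂.conj t = κ * P₁.conj t * κ⁻¹ := fun t => by
    rw [← hμ t, mul_inv_cancel_right₀ hκ]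
  have hε : P₂.ε = κ * (P₁.conj κ)⁻¹ * P₁.ε := by
    -- `B₂ f e` is computed twice: by the factor of `f`, and by reflexivity from `B₂ e f`.
    have h1 := hf e
    rw [hG.reflexive e f, hF.reflexive e f, he, hσ, P₁.conj_mul] at h1
    have h2 := mul_left_cancel₀ (mul_ne_zero hκ (P₁.conj_ne_zero h.ef))
      (show κ * P₁.conj (B₁ e f) * (P₁.conj κ * κ⁻¹ * P₂.ε) = κ * P₁.conj (B₁ e f) * P₁.ε by
        simpa only [mul_assoc] using h1)
    rw [← h2]
    simp [mul_assoc, hκ, hκ']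
  have hswap : ∀ x y, B₂ x y = κ * B₁ x y → B₂ y x = κ * B₁ y x := by
    intro x y hxy
    rw [hG.reflexive x y, hF.reflexive x y, hxy, hσ, P₁.conj_mul, hε]
    simp [mul_assoc, hκ, hκ']
  refine ⟨κ, hκ, ?_, ?_⟩
  · apply AdmissiblePair.ext
    · ext t
      exact congrArg op (hσ t)
    · exact hε
  · let G : AddSubgroup V :=
      { carrier := {x | ∀ y, B₂ x y = κ * B₁ x y}
        zero_mem' := fun y => by rw [hG.zero_left, hF.zero_left, mul_zero]
        add_mem' := fun {x x'} hx hx' y => by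
          rw [hG.add_left, hF.add_left, hx y, hx' y, mul_add]
        neg_mem' := fun {x} hx y => by rw [hG.neg_left, hF.neg_left, hx y, mul_neg] }
    have hsmul : ∀ (a : K) (x : V), x ∈ G → op a • x ∈ G := fun a x hx y => by
      rw [hG.smul_left, hF.smul_left, hx y, ← mul_assoc, ← mul_assoc, hμ]
    let W : AddSubgroup V :=
      { carrier := {x | B₁ x c = 0 ∧ B₁ x d = 0}
        zero_mem' := ⟨hF.zero_left c, hF.zero_left d⟩
        add_mem' := fun {x x'} hx hx' => by
          constructor
          · rw [hF.add_left, hx.1, hx'.1, add_zero]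
          · rw [hF.add_left, hx.2, hx'.2, add_zero]
        neg_mem' := fun {x} hx => by
          constructor
          · rw [hF.neg_left, hx.1, neg_zero]
          · rw [hF.neg_left, hx.2, neg_zero] }
    have hWG : W ≤ G := by
      refine hB₁.le_of_hyperbolic_mem W G h.e_sing (hF.ne_zero_swap h.ef) ?_ ⟨h.fc, h.fd⟩
        (fun a => hsmul a e he) hf ?_
      · intro a
        constructor
        · rw [hF.smul_left, h.ec, mul_zero]
        · rw [hF.smul_left, h.ed, mul_zero]
      · intro w hw hqw hwe
        -- The pair `c, d` lies in `w^⊥`, so `w` has a factor `τ`; evaluation at `e` forces `τ = κ`.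
        obtain ⟨τ, hτ⟩ := hB₁.exists_eq_mul hB₂ hQ hqw h.c_sing h.d_sing hwe hw.1 hw.2 h.cd
        have h1 := hswap e w (he w)
        rw [hτ e] at h1
        rw [mul_right_cancel₀ hwe h1] at hτ
        exact hτ
    intro x
    have hdc := hF.ne_zero_swap h.cd
    have key : x - op ((B₁ d c)⁻¹ * B₁ d x) • c - op ((B₁ c d)⁻¹ * B₁ c x) • d ∈ W := by
      constructor
      · apply hF.eq_zero_swap
        simp only [hF.sub_right, hF.smul_right, hB₁.self_eq_zero h.c_sing]
        rw [mul_inv_cancel_left₀ h.cd, zero_mul, sub_zero, sub_self]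
      · apply hF.eq_zero_swap
        simp only [hF.sub_right, hF.smul_right, hB₁.self_eq_zero h.d_sing]
        rw [mul_inv_cancel_left₀ hdc, zero_mul, sub_self, sub_zero]
    have h1 := G.add_mem (G.add_mem (hWG key) (hsmul ((B₁ c d)⁻¹ * B₁ c x) d hd))
      (hsmul ((B₁ d c)⁻¹ * B₁ d x) c hc)
    rwa [sub_add_cancel, sub_add_cancel] at h1

theorem IsPolarForm.proportional (hB₁ : q₁.IsPolarForm B₁) (hB₂ : q₂.IsPolarForm B₂)
    (hQ : ∀ v, q₁.toFun v = 0 ↔ q₂.toFun v = 0) {e f : V} (he : q₁.toFun e = 0)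
    (hf : q₁.toFun f = 0) (hef : B₁ e f ≠ 0) {κ : K} (hκ : κ ≠ 0) (hP : P₂ = P₁.scale κ hκ)
    (hB : ∀ x y, B₂ x y = κ * B₁ x y) : q₁.Proportional q₂ := by
  -- On the vectors `e + fλ` the form `q₁` takes every class as value, so its zeros there determine
  -- the co-defect.
  have hcls : ∀ t, R₁.cls t = 0 ↔ R₂.cls (κ * t) = 0 := by
    intro t
    have h1 : q₁.toFun (e + op ((B₁ e f)⁻¹ * t) • f) = R₁.cls t := by
      rw [hB₁.map_add_of_singular he (q₁.map_smul_eq_zero hf _), hB₁.form.smul_right,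
        mul_inv_cancel_left₀ hef]
    have h2 : q₂.toFun (e + op ((B₁ e f)⁻¹ * t) • f) = R₂.cls (κ * t) := by
      rw [hB₂.map_add_of_singular ((hQ e).1 he) (q₂.map_smul_eq_zero ((hQ f).1 hf) _),
        hB₂.form.smul_right, hB, mul_assoc, mul_inv_cancel_left₀ hef]
    rw [← h1, ← h2]
    exact hQ _
  have hR : R₂.carrier = R₁.carrier.map (AdmissiblePair.mulLeftBar hP) := by
    ext r
    rw [AddSubgroup.mem_map]
    constructor
    · intro hr
      obtain ⟨t, rfl⟩ := QuotientAddGroup.mk_surjective r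
      refine ⟨QuotientAddGroup.mk (κ⁻¹ * t), ?_, ?_⟩
      · rw [← R₁.cls_eq_zero_iff, hcls, mul_inv_cancel_left₀ hκ, R₂.cls_eq_zero_iff]
        exact hr
      · change QuotientAddGroup.mk (κ * (κ⁻¹ * t)) = _
        rw [mul_inv_cancel_left₀ hκ]
    · rintro ⟨s, hs, rfl⟩
      obtain ⟨t, rfl⟩ := QuotientAddGroup.mk_surjective s
      exact (R₂.cls_eq_zero_iff _).1 ((hcls t).1 ((R₁.cls_eq_zero_iff t).2 hs))
  refine ⟨κ, hκ, hP, hR, ?_⟩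
  -- Additive because the polar terms cancel by `B₂ = κB₁`.
  let δ : V →+ P₂.Kbar ⧸ R₂.carrier :=
    AddMonoidHom.mk' (fun x => q₂.toFun x - AdmissiblePair.mulLeftQuot hP hR (q₁.toFun x))
      fun x y => by
        have h1 : AdmissiblePair.mulLeftQuot hP hR (R₁.cls (B₁ x y)) = R₂.cls (κ * B₁ x y) := rfl
        rw [hB₁.map_add, hB₂.map_add, hB, _root_.map_add, _root_.map_add, h1]
        abel
  have hδ : ∀ x, q₁.toFun x = 0 → x ∈ δ.ker := by
    intro x hx
    change q₂.toFun x - _ = 0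
    rw [hx, (hQ x).1 hx, _root_.map_zero, sub_zero]
  have htop : ⊤ ≤ δ.ker :=
    hB₁.le_of_hyperbolic_mem ⊤ δ.ker he (hB₁.form.ne_zero_swap hef) (fun _ => trivial) trivial
      (fun a => hδ _ (q₁.map_smul_eq_zero he a)) (hδ f hf) fun w _ hw _ => hδ w hw
  intro x
  exact sub_eq_zero.1 (htop (AddSubgroup.mem_top x))

end Comparison

end GenQuadraticForm

theorem theorem3p8 {K : Type*} [DivisionRing K] {V : Type*} [AddCommGroup V] [Module Kᵐᵒᵖ V]
    {P₁ P₂ : AdmissiblePair K} {R₁ : P₁.ClosedSubgroup} {R₂ : P₂.ClosedSubgroup}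
    (q₁ : GenQuadraticForm P₁ R₁ V) (q₂ : GenQuadraticForm P₂ R₂ V)
    (hS : q₁.polarSpace = q₂.polarSpace)
    (hrank : 2 ≤ q₁.polarSpace.nondegenerateRank) :
    q₁.Proportional q₂ := by
  have hQ := GenQuadraticForm.eq_zero_iff_of_polarSpace_eq hS
  obtain ⟨B₁, e, f, c, d, hB₁, h⟩ := GenQuadraticForm.exists_hyperbolicQuadruple hrank
  obtain ⟨v, hv⟩ : ∃ v, q₁.toFun v ≠ 0 := by
    by_contra! hall
    exact h.ef (hB₁.eq_zero_of_forall h.e_sing h.f_sing fun _ => hall _)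
  obtain ⟨B₂, hB₂⟩ := q₂.exists_isPolarForm fun h' => hv ((hQ v).2 h')
  obtain ⟨κ, hκ, hP, hB⟩ := hB₁.exists_scale hB₂ hQ h
  exact hB₁.proportional hB₂ hQ h.e_sing h.f_sing h.ef hκ hP hB
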